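/- Let $G$ be a finite group and $n\ge 0$ an integer. For $\pi\in S_n$ let $Pr_\pi(G)$ be the probability that $a_1a_2\cdots a_n=a_{\pi(1)}a_{\pi(2)}\cdots a_{\pi(n)}$ for independent uniformly random $a_1,\dots,a_n\in G$, i.e. the number of solutions in $G^n$ divided by $|G|^n$. Let $Pr^m(G)=Pr_\pi(G)$ for the order-reversing permutation $\pi=\langle m\;\,m-1\;\cdots\;2\;\,1\rangle\in S_m$, and let $Spec_n(G)=\{Pr_\pi(G):\pi\in S_n\}$. For $\phi\in S_n$ put $\phi_0=0$ and $\phi_i=\phi(i)$. The cycle graph $Gr(\phi)$ is the bicoloured directed graph on the vertices $0,1,\dots,n$ with black edges $\phi_n\to\phi_{n-1}\to\cdots\to\phi_0\to\phi_n$ and grey edges $0\to1\to\cdots\to n\to0$. An alternating cycle of $Gr(\phi)$ is a nonempty closed directed walk without repeated edges, up to cyclic rotation, in which any two cyclically consecutive edges have different colours; every edge lies in exactly one alternating cycle. A Hultman class of $S_n$ is the set of all permutations whose cycle graphs have a given number of alternating cycles, when this set is nonempty. (a) Let $\phi\in S_n$ and let $k$ be the number of alternating cycles of $Gr(\phi)$.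 Then $k\le n+1$. If $k\le n$, then $k\le n-1$, $n-k$ is odd, and $$Pr_\phi(G)=Pr^{n+1-k}(G)=Pr(a_1a_2\cdots a_{n+1-k}=a_{n+1-k}\cdots a_2a_1).$$ Moreover $k=n+1$ if and only if $\phi$ is the identity, and in this case $Pr_\phi(G)=1$. (b) Let $G$ be non-abelian. For all $\phi,\theta\in S_n$, $Pr_\phi(G)=Pr_\theta(G)$ if and only if $Gr(\phi)$ and $Gr(\theta)$ have the same number of alternating cycles. Consequently $p\mapsto\{\pi\in S_n: Pr_\pi(G)=p\}$ is a bijection from $Spec_n(G)$ onto the set of Hultman classes of $S_n$, and $Spec_n(G)$ has exactly $\lfloor n/2\rfloor+1$ elements. -/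

import Mathlib

namespace Hultman

/-! ### Probabilities of permutation equalities -/

/-- The probability that a uniformly random `m`-tuple of elements of the finite group `G`
satisfies `P`: the number of such tuples divided by `|G| ^ m`. -/
noncomputable def prob (G : Type*) {m : ℕ} (P : (Fin m → G) → Prop) : ℚ :=
  (Nat.card {a : Fin m → G // P a} : ℚ) / (Nat.card G : ℚ) ^ m

/-- `Pr_π(G)`, the probability that `a₁ a₂ ⋯ aₙ = a_{π₁} a_{π₂} ⋯ a_{πₙ}`. The positions and
the values `1, …, n` of the one-row notation are numbered `0, …, n - 1` by `Fin n`. -/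
noncomputable def permProb (G : Type*) [Group G] {n : ℕ} (π : Equiv.Perm (Fin n)) : ℚ :=
  prob G fun a : Fin n → G => (List.ofFn a).prod = (List.ofFn fun i => a (π i)).prod

/-- `Pr^m(G)`, which is `Pr_π(G)` for `π = ⟨m m-1 ⋯ 2 1⟩`. -/
noncomputable def revProb (G : Type*) [Group G] (m : ℕ) : ℚ :=
  permProb G (Fin.revPerm : Equiv.Perm (Fin m))

/-- `Spec_n(G)`, the set of all `Pr_π(G)`, where `π` runs over `S_n`. -/
def spec (G : Type*) [Group G] (n : ℕ) : Set ℚ :=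
  Set.range fun π : Equiv.Perm (Fin n) => permProb G π

/-! ### The cycle graph and its alternating cycles -/

/-- The two colours of the edges of a cycle graph. -/
inductive Colour : Type
  | black : Colour
  | grey : Colour

/-- A coloured directed edge (arrow) on the vertex set `V`. -/
structure Arrow (V : Type*) where
  /-- the colour -/
  colour : Colour
  /-- the initial vertex -/
  source : V
  /-- the final vertex -/
  target : V

/-- The sequence `φ₀ = 0, φ₁, …, φₙ` of the vertices of the cycle graph of `φ`. The vertices are
`0, 1, …, n`, so the value `v : Fin n` of the permutation is the vertex `v.succ`. -/
def vertexSeq {n : ℕ} (φ : Equiv.Perm (Fin n)) : Fin (n + 1) → Fin (n + 1) :=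
  Fin.cons 0 fun i => (φ i).succ

/-- The edge set of the cycle graph `Gr(φ)`: the black edges `φₙ → φₙ₋₁ → ⋯ → φ₀ → φₙ` and the
grey edges `0 → 1 → ⋯ → n → 0`. Addition and subtraction in `Fin (n + 1)` are modulo `n + 1`. -/
def cycleGraph {n : ℕ} (φ : Equiv.Perm (Fin n)) : Set (Arrow (Fin (n + 1))) :=
  {e | ∃ i : Fin (n + 1), e = ⟨Colour.black, vertexSeq φ i, vertexSeq φ (i - 1)⟩} ∪
  {e | ∃ i : Fin (n + 1), e = ⟨Colour.grey, i, i + 1⟩}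

/-- A nonempty cyclic sequence of pairwise distinct edges of `E`, each of which ends
where the cyclically next one starts and has the other colour. -/
def IsAlternatingCycle {V : Type*} (E : Set (Arrow V)) (c : Cycle (Arrow V)) : Prop :=
  c ≠ Cycle.nil ∧ c.Nodup ∧ (∀ e ∈ c, e ∈ E) ∧
    c.Chain fun e f => e.target = f.source ∧ e.colour ≠ f.colour

/-- The number of alternating cycles of `Gr(φ)`. -/
noncomputable def numAltCycles {n : ℕ} (φ : Equiv.Perm (Fin n)) : ℕ :=
  {c : Cycle (Arrow (Fin (n + 1))) | IsAlternatingCycle (cycleGraph φ) c}.ncard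

/-- The Hultman class of `φ`: the permutations whose cycle graph has as many alternating cycles
as that of `φ`. -/
def hultmanClass {n : ℕ} (φ : Equiv.Perm (Fin n)) : Set (Equiv.Perm (Fin n)) :=
  {θ | numAltCycles θ = numAltCycles φ}

/-- The Hultman decomposition of `S_n`: the set of all Hultman classes. -/
def hultmanDecomposition (n : ℕ) : Set (Set (Equiv.Perm (Fin n))) :=
  Set.range fun φ : Equiv.Perm (Fin n) => hultmanClass φ

end Hultman

/-! Let the letter `inl x` stand for a_x and `inr x` for its inverse, with a_0 = 1. The equation for
φ says that one cyclic word, made of all grey letters followed by all black ones, has product 1.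
Replace the product of a cyclic word by the sum `conjSum` of its conjugates, a central element of
the group algebra that does not depend on where the word starts. Summing over the value of a single
letter then has a closed form. If the letter and its inverse lie in one word, that word splits in
two (`sum_conjSum_split`). If they lie in two words, the words are joined and a factor `commSum`,
the sum of all commutators, appears (`sum_conjSum_join`). In both cases the successor map of the
letters is composed with the swap of `inl x` and `inr x`. After all n letters the successor map is
`nextEdge`, so the remaining words, now trivial, are the k alternating cycles. With h joins, k + 2h
= n + 1, and Pr_φ(G) is the probability `commProb G h` that a product of h random commutators is 1
(`exists_permProb_eq`).

The reversal of 2h letters has a single alternating cycle, so it has the same probability. This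
gives (a).

For (b), `commProb` must be injective. Multiplication by `commSum` has, up to a positive scalar, a
Gram matrix of independent columns, so its powers are positive definite. Hence the coefficient of
`commSum ^ h` at 1 strictly exceeds every other one, and in a non-abelian group one more commutator
strictly lowers the probability. -/

namespace Hultman

/-! ### Decompositions of a set into cycles of a map -/

/-- `ws` consists of nonempty cyclic sequences which are closed under `c` and
contain together each element exactly once. -/
structure IsCycleDecomposition {D : Type*} (c : D → D) (ws : Multiset (Cycle D)) : Prop where
  nodup : (ws.bind Cycle.toMultiset).Nodup
  exists_mem : ∀ d, ∃ C ∈ ws, d ∈ C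
  ne_nil : ∀ C ∈ ws, C ≠ Cycle.nil
  chain : ∀ C ∈ ws, C.Chain fun x y => c x = y

theorem mem_toMultiset {D : Type*} {C : Cycle D} {d : D} : d ∈ C.toMultiset ↔ d ∈ C := by
  induction C using Quotient.inductionOn'; rfl

theorem exists_cons_of_mem {D : Type*} {C : Cycle D} {d : D} (h : d ∈ C) :
    ∃ L : List D, C = ((d :: L : List D) : Cycle D) := by
  induction C using Quotient.inductionOn' with
  | h l =>
    have h : d ∈ l := h
    obtain ⟨s, t, rfl⟩ := List.append_of_mem h
    exact ⟨t ++ s, Quotient.sound' (List.isRotated_append (l := s) (l' := d :: t))⟩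

/-- Composing with the swap changes `c` only where it takes the value `b` or `b'`. On a path whose
interior avoids both, only the last step can be redirected. -/
theorem isChain_swap_comp {D : Type*} [DecidableEq D] {c : D → D} {b b' : D} :
    ∀ {x y : D} {L : List D}, b ∉ L → b' ∉ L →
      List.IsChain (fun x y => c x = y) (x :: (L ++ [y])) →
      List.IsChain (fun x y => Equiv.swap b b' (c x) = y) (x :: (L ++ [Equiv.swap b b' y]))
  | x, y, [], _, _, h => by simpa using h
  | x, y, z :: L, hb, hb', h => by
    simp only [List.cons_append, List.isChain_cons_cons, List.mem_cons, not_or] at h hb hb' ⊢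
    refine ⟨?_, isChain_swap_comp hb.2 hb'.2 h.2⟩
    rw [h.1, Equiv.swap_apply_of_ne_of_ne (Ne.symm hb.1) (Ne.symm hb'.1)]

theorem chain_append_iff {D : Type*} {r : D → D → Prop} {b b' : D} {U V : List D} :
    Cycle.Chain r ((b :: U ++ b' :: V : List D) : Cycle D) ↔
      List.IsChain r (b :: (U ++ [b'])) ∧ List.IsChain r (b' :: (V ++ [b])) := by
  rw [List.cons_append, Cycle.chain_coe_cons]
  have := List.isChain_split (R := r) (c := b') (l₁ := b :: U) (l₂ := V ++ [b])
  simpa using this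

theorem chain_swap_comp_of_ne {D : Type*} [DecidableEq D] {c : D → D} {b b' : D} {C : Cycle D}
    (hb : b ∉ C) (hb' : b' ∉ C) (h : C.Chain fun x y => c x = y) :
    C.Chain fun x y => Equiv.swap b b' (c x) = y := by
  induction C using Quotient.inductionOn' with
  | h l =>
    cases l with
    | nil => exact Cycle.Chain.nil _
    | cons x L =>
      have hb : b ∉ x :: L := hb
      have hb' : b' ∉ x :: L := hb'
      change Cycle.Chain _ ((x :: L : List D) : Cycle D) at h
      change Cycle.Chain _ ((x :: L : List D) : Cycle D)
      simp only [List.mem_cons, not_or] at hb hb'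
      rw [Cycle.chain_coe_cons] at h ⊢
      have := isChain_swap_comp hb.2 hb'.2 h
      rwa [Equiv.swap_apply_of_ne_of_ne (Ne.symm hb.1) (Ne.symm hb'.1)] at this

namespace IsCycleDecomposition

variable {D : Type*} {c : D → D}

/-- The cycle consists of a path from `b` to `b'` and one from `b'` to `b`. The swap redirects the
end of each path to its own start, and no other cycle meets `b` or `b'`. -/
theorem split [DecidableEq D] {b b' : D} {U V : List D} {ws : Multiset (Cycle D)}
    (h : IsCycleDecomposition c (((b :: U ++ b' :: V : List D) : Cycle D) ::ₘ ws)) :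
    IsCycleDecomposition (fun x => Equiv.swap b b' (c x))
      (((b :: U : List D) : Cycle D) ::ₘ ((b' :: V : List D) : Cycle D) ::ₘ ws) := by
  have hn := h.nodup
  simp only [Multiset.cons_bind, Cycle.coe_toMultiset, Multiset.nodup_add, Multiset.coe_nodup,
    Multiset.disjoint_left, Multiset.mem_coe] at hn
  obtain ⟨h1, h2, h3⟩ := hn
  rw [List.nodup_append] at h1
  simp only [List.nodup_cons, List.mem_cons] at h1
  obtain ⟨⟨hbU, -⟩, ⟨hbV, -⟩, h4⟩ := h1
  have hc := h.chain _ (Multiset.mem_cons_self _ _)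
  rw [chain_append_iff] at hc
  refine ⟨?_, ?_, ?_, ?_⟩
  · have := h.nodup
    simpa only [Multiset.cons_bind, Cycle.coe_toMultiset, ← add_assoc, Multiset.coe_add] using this
  · intro d
    obtain ⟨C, hC, hd⟩ := h.exists_mem d
    rcases Multiset.mem_cons.1 hC with rfl | hC
    · rw [Cycle.mem_coe_iff, List.mem_append] at hd
      rcases hd with hd | hd
      · exact ⟨_, Multiset.mem_cons_self _ _, hd⟩
      · exact ⟨_, Multiset.mem_cons_of_mem (Multiset.mem_cons_self _ _), hd⟩
    · exact ⟨C, Multiset.mem_cons_of_mem (Multiset.mem_cons_of_mem hC), hd⟩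
  · intro C hC
    simp only [Multiset.mem_cons] at hC
    rcases hC with rfl | rfl | hC
    · simp
    · simp
    · exact h.ne_nil C (Multiset.mem_cons_of_mem hC)
  · intro C hC
    simp only [Multiset.mem_cons] at hC
    rcases hC with rfl | rfl | hC
    · rw [Cycle.chain_coe_cons]
      have := isChain_swap_comp (b := b) (b' := b') hbU
        (fun hm => h4 b' (Or.inr hm) b' (Or.inl rfl) rfl) hc.1
      rwa [Equiv.swap_apply_right] at this
    · rw [Cycle.chain_coe_cons]
      have := isChain_swap_comp (b := b) (b' := b')
        (fun hm => h4 b (Or.inl rfl) b (Or.inr hm) rfl) hbV hc.2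
      rwa [Equiv.swap_apply_left] at this
    · have hmem : ∀ d ∈ C, d ∈ ws.bind Cycle.toMultiset := fun d hd =>
        Multiset.mem_bind.2 ⟨C, hC, mem_toMultiset.2 hd⟩
      exact chain_swap_comp_of_ne (fun hb => h3 (by simp) (hmem _ hb))
        (fun hb => h3 (by simp) (hmem _ hb)) (h.chain C (Multiset.mem_cons_of_mem hC))

/-- The inverse surgery to `split`: each of the two closed paths is made to end at the start of the
other. -/
theorem join [DecidableEq D] {b b' : D} {U V : List D} {ws : Multiset (Cycle D)}
    (h : IsCycleDecomposition c
      (((b :: U : List D) : Cycle D) ::ₘ ((b' :: V : List D) : Cycle D) ::ₘ ws)) :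
    IsCycleDecomposition (fun x => Equiv.swap b b' (c x))
      (((b :: U ++ b' :: V : List D) : Cycle D) ::ₘ ws) := by
  have hnod : ((((b :: U ++ b' :: V : List D) : Cycle D) ::ₘ ws).bind Cycle.toMultiset).Nodup := by
    have := h.nodup
    simpa only [Multiset.cons_bind, Cycle.coe_toMultiset, ← add_assoc, Multiset.coe_add] using this
  have hn := hnod
  simp only [Multiset.cons_bind, Cycle.coe_toMultiset, Multiset.nodup_add, Multiset.coe_nodup,
    Multiset.disjoint_left, Multiset.mem_coe] at hn
  obtain ⟨h1, h2, h3⟩ := hn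
  rw [List.nodup_append] at h1
  simp only [List.nodup_cons, List.mem_cons] at h1
  obtain ⟨⟨hbU, -⟩, ⟨hbV, -⟩, h4⟩ := h1
  have hc := h.chain _ (Multiset.mem_cons_self _ _)
  have hc' := h.chain _ (Multiset.mem_cons_of_mem (Multiset.mem_cons_self _ _))
  rw [Cycle.chain_coe_cons] at hc hc'
  refine ⟨hnod, ?_, ?_, ?_⟩
  · intro d
    obtain ⟨C, hC, hd⟩ := h.exists_mem d
    simp only [Multiset.mem_cons] at hC
    rcases hC with rfl | rfl | hC
    · exact ⟨_, Multiset.mem_cons_self _ _, List.mem_append_left _ hd⟩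
    · exact ⟨_, Multiset.mem_cons_self _ _, List.mem_append_right _ hd⟩
    · exact ⟨C, Multiset.mem_cons_of_mem hC, hd⟩
  · intro C hC
    simp only [Multiset.mem_cons] at hC
    rcases hC with rfl | hC
    · simp
    · exact h.ne_nil C (Multiset.mem_cons_of_mem (Multiset.mem_cons_of_mem hC))
  · intro C hC
    simp only [Multiset.mem_cons] at hC
    rcases hC with rfl | hC
    · rw [chain_append_iff]
      constructor
      · have := isChain_swap_comp (b := b) (b' := b') hbU
          (fun hm => h4 b' (Or.inr hm) b' (Or.inl rfl) rfl) hc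
        rwa [Equiv.swap_apply_left] at this
      · have := isChain_swap_comp (b := b) (b' := b')
          (fun hm => h4 b (Or.inl rfl) b (Or.inr hm) rfl) hbV hc'
        rwa [Equiv.swap_apply_right] at this
    · have hmem : ∀ d ∈ C, d ∈ ws.bind Cycle.toMultiset := fun d hd =>
        Multiset.mem_bind.2 ⟨C, hC, mem_toMultiset.2 hd⟩
      exact chain_swap_comp_of_ne (fun hb => h3 (by simp) (hmem _ hb))
        (fun hb => h3 (by simp) (hmem _ hb))
        (h.chain C (Multiset.mem_cons_of_mem (Multiset.mem_cons_of_mem hC)))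

end IsCycleDecomposition

/-! ### Uniqueness of the cycles of a map -/

theorem apply_mem_of_chain {D : Type*} {c : D → D} {C : Cycle D}
    (h : C.Chain fun x y => c x = y) {x : D} (hx : x ∈ C) : c x ∈ C := by
  obtain ⟨L, rfl⟩ := exists_cons_of_mem hx
  rw [Cycle.chain_coe_cons] at h
  cases L with
  | nil => simp at h; simp [h]
  | cons y L =>
    simp only [List.cons_append, List.isChain_cons_cons] at h
    simp [h.1]

theorem eq_of_isChain_of_nodup {D : Type*} {c : D → D} {z : D} :
    ∀ {x : D} {L L' : List D}, z ∉ L → z ∉ L' →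
      List.IsChain (fun x y => c x = y) (x :: (L ++ [z])) →
      List.IsChain (fun x y => c x = y) (x :: (L' ++ [z])) → L = L'
  | _, [], [], _, _, _, _ => rfl
  | x, [], y :: L', _, h', h1, h2 => by
    simp only [List.nil_append, List.cons_append, List.isChain_cons_cons, List.mem_cons,
      not_or] at h1 h2 h'
    exact absurd (h1.1.symm.trans h2.1) h'.1
  | x, y :: L, [], h, _, h1, h2 => by
    simp only [List.nil_append, List.cons_append, List.isChain_cons_cons, List.mem_cons,
      not_or] at h1 h2 h
    exact absurd (h2.1.symm.trans h1.1) h.1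
  | x, y :: L, y' :: L', h, h', h1, h2 => by
    simp only [List.cons_append, List.isChain_cons_cons, List.mem_cons, not_or] at h1 h2 h h'
    obtain rfl : y = y' := h1.1.symm.trans h2.1
    rw [eq_of_isChain_of_nodup h.2 h'.2 h1.2 h2.2]

/-- A cycle of a map is determined by any of its elements. -/
theorem cycle_eq_of_chain {D : Type*} {c : D → D} {C C' : Cycle D} (hC : C.Nodup) (hC' : C'.Nodup)
    (h : C.Chain fun x y => c x = y) (h' : C'.Chain fun x y => c x = y) {x : D} (hx : x ∈ C)
    (hx' : x ∈ C') : C = C' := by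
  obtain ⟨L, rfl⟩ := exists_cons_of_mem hx
  obtain ⟨L', rfl⟩ := exists_cons_of_mem hx'
  rw [Cycle.chain_coe_cons] at h h'
  rw [Cycle.nodup_coe_iff, List.nodup_cons] at hC hC'
  rw [eq_of_isChain_of_nodup hC.1 hC'.1 h h']

theorem nodup_iff_toMultiset {D : Type*} {C : Cycle D} : C.toMultiset.Nodup ↔ C.Nodup := by
  induction C using Quotient.inductionOn'; rfl

theorem exists_mem_of_ne_nil {D : Type*} {C : Cycle D} (h : C ≠ Cycle.nil) : ∃ d, d ∈ C := by
  induction C using Quotient.inductionOn' with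
  | h l =>
    cases l with
    | nil => exact absurd rfl h
    | cons x L => exact ⟨x, List.mem_cons_self⟩

namespace IsCycleDecomposition

variable {D : Type*} {c : D → D} {ws : Multiset (Cycle D)}

theorem nodup_of_mem (h : IsCycleDecomposition c ws) {C : Cycle D} (hC : C ∈ ws) : C.Nodup := by
  obtain ⟨t, rfl⟩ := Multiset.exists_cons_of_mem hC
  have := h.nodup
  rw [Multiset.cons_bind, Multiset.nodup_add] at this
  exact nodup_iff_toMultiset.1 this.1

theorem nodup_cycles (h : IsCycleDecomposition c ws) : ws.Nodup := by
  classical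
  rw [Multiset.nodup_iff_ne_cons_cons]
  rintro C t rfl
  have hn := h.nodup
  obtain ⟨d, hd⟩ := exists_mem_of_ne_nil (h.ne_nil C (Multiset.mem_cons_self _ _))
  rw [Multiset.cons_bind, Multiset.cons_bind, Multiset.nodup_add] at hn
  exact Multiset.disjoint_left.1 hn.2.2 (mem_toMultiset.2 hd)
    (Multiset.mem_add.2 (Or.inl (mem_toMultiset.2 hd)))

/-- The cycles of a decomposition are all the cycles of the map. -/
theorem mem_iff (h : IsCycleDecomposition c ws) {C : Cycle D} :
    C ∈ ws ↔ C ≠ Cycle.nil ∧ C.Nodup ∧ C.Chain fun x y => c x = y := by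
  refine ⟨fun hC => ⟨h.ne_nil C hC, h.nodup_of_mem hC, h.chain C hC⟩, fun ⟨h1, h2, h3⟩ => ?_⟩
  obtain ⟨d, hd⟩ := exists_mem_of_ne_nil h1
  obtain ⟨C', hC', hd'⟩ := h.exists_mem d
  rwa [cycle_eq_of_chain h2 (h.nodup_of_mem hC') h3 (h.chain C' hC') hd hd']

end IsCycleDecomposition

/-! ### The alternating cycles of a cycle graph -/

theorem vertexSeq_bijective {n : ℕ} (φ : Equiv.Perm (Fin n)) :
    Function.Bijective (vertexSeq φ) := by
  rw [← Finite.injective_iff_bijective, vertexSeq, Fin.cons_injective_iff]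
  refine ⟨?_, (Fin.succ_injective n).comp φ.injective⟩
  rintro ⟨i, hi⟩
  exact Fin.succ_ne_zero _ hi

/-- The permutation `φ` as a permutation of the vertices that fixes `0`. -/
noncomputable def vertexPerm {n : ℕ} (φ : Equiv.Perm (Fin n)) : Equiv.Perm (Fin (n + 1)) :=
  Equiv.ofBijective _ (vertexSeq_bijective φ)

theorem vertexSeq_eq {n : ℕ} (φ : Equiv.Perm (Fin n)) : vertexSeq φ = vertexPerm φ := rfl

@[simp] theorem vertexPerm_zero {n : ℕ} (φ : Equiv.Perm (Fin n)) : vertexPerm φ 0 = 0 := rfl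

@[simp] theorem vertexPerm_succ {n : ℕ} (φ : Equiv.Perm (Fin n)) (i : Fin n) :
    vertexPerm φ i.succ = (φ i).succ := rfl

/-- The edges of the cycle graph of `s`: `inl x` is the grey edge and `inr x` the black edge
that starts at `x`. -/
def edge {n : ℕ} (s : Equiv.Perm (Fin (n + 1))) :
    Fin (n + 1) ⊕ Fin (n + 1) → Arrow (Fin (n + 1))
  | Sum.inl x => ⟨Colour.grey, x, x + 1⟩
  | Sum.inr x => ⟨Colour.black, x, s (s.symm x - 1)⟩

/-- The edge that follows a given edge in its alternating cycle. -/
def nextEdge {n : ℕ} (s : Equiv.Perm (Fin (n + 1))) :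
    Fin (n + 1) ⊕ Fin (n + 1) → Fin (n + 1) ⊕ Fin (n + 1)
  | Sum.inl x => Sum.inr (x + 1)
  | Sum.inr x => Sum.inl (s (s.symm x - 1))

theorem edge_injective {n : ℕ} (s : Equiv.Perm (Fin (n + 1))) : Function.Injective (edge s) := by
  rintro (x | x) (y | y) h <;> simp_all [edge]

theorem range_edge {n : ℕ} (φ : Equiv.Perm (Fin n)) :
    Set.range (edge (vertexPerm φ)) = cycleGraph φ := by
  ext e
  constructor
  · rintro ⟨x | x, rfl⟩
    · exact Or.inr ⟨x, rfl⟩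
    · refine Or.inl ⟨(vertexPerm φ).symm x, ?_⟩
      simp [edge, vertexSeq_eq]
  · rintro (⟨i, rfl⟩ | ⟨i, rfl⟩)
    · refine ⟨Sum.inr (vertexPerm φ i), ?_⟩
      simp [edge, vertexSeq_eq]
    · exact ⟨Sum.inl i, rfl⟩

/-- Exactly one edge of each colour leaves each vertex, so an alternating walk is deterministic.
This makes alternating cycles the cycles of a map. -/
theorem alternating_iff_nextEdge {n : ℕ} (s : Equiv.Perm (Fin (n + 1)))
    (d d' : Fin (n + 1) ⊕ Fin (n + 1)) :
    ((edge s d).target = (edge s d').source ∧ (edge s d).colour ≠ (edge s d').colour) ↔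
      nextEdge s d = d' := by
  rcases d with x | x <;> rcases d' with y | y <;> simp [edge, nextEdge]

theorem cycle_map_injective {α β : Type*} {f : α → β} (hf : Function.Injective f) :
    Function.Injective (Cycle.map f) := by
  intro C C' h
  induction C using Quotient.inductionOn' with
  | h l =>
    induction C' using Quotient.inductionOn' with
    | h l' =>
      change ((l.map f : List β) : Cycle β) = ((l'.map f : List β) : Cycle β) at h
      rw [Cycle.coe_eq_coe] at h
      obtain ⟨m, hm⟩ := h
      rw [← List.map_rotate] at hm
      exact Quotient.sound' ⟨m, List.map_injective_iff.2 hf hm⟩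

theorem exists_cycle_map_eq {α β : Type*} {f : α → β} {C : Cycle β}
    (h : ∀ b ∈ C, b ∈ Set.range f) : ∃ C' : Cycle α, C'.map f = C := by
  induction C using Quotient.inductionOn' with
  | h l =>
    obtain ⟨l', rfl⟩ : l ∈ Set.range (List.map f) := by
      rw [Set.range_list_map]; exact h
    exact ⟨l', rfl⟩

theorem nodup_cycle_map_iff {α β : Type*} {f : α → β} (hf : Function.Injective f) {C : Cycle α} :
    (C.map f).Nodup ↔ C.Nodup := by
  induction C using Quotient.inductionOn' with
  | h l => exact List.nodup_map_iff hf

theorem isAlternatingCycle_map_iff {n : ℕ} (φ : Equiv.Perm (Fin n))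
    (C : Cycle (Fin (n + 1) ⊕ Fin (n + 1))) :
    IsAlternatingCycle (cycleGraph φ) (C.map (edge (vertexPerm φ))) ↔
      C ≠ Cycle.nil ∧ C.Nodup ∧ C.Chain fun x y => nextEdge (vertexPerm φ) x = y := by
  rw [IsAlternatingCycle, Ne, Cycle.map_eq_nil, nodup_cycle_map_iff (edge_injective _),
    Cycle.chain_map]
  simp only [alternating_iff_nextEdge, ← range_edge]
  have : ∀ e ∈ C.map (edge (vertexPerm φ)), e ∈ Set.range (edge (vertexPerm φ)) := by
    intro e he
    obtain ⟨d, -, rfl⟩ := Cycle.mem_map.1 he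
    exact ⟨d, rfl⟩
  tauto

theorem numAltCycles_eq_card {n : ℕ} {φ : Equiv.Perm (Fin n)}
    {ws : Multiset (Cycle (Fin (n + 1) ⊕ Fin (n + 1)))}
    (h : IsCycleDecomposition (nextEdge (vertexPerm φ)) ws) :
    numAltCycles φ = Multiset.card ws := by
  classical
  have hset : {c | IsAlternatingCycle (cycleGraph φ) c} =
      Cycle.map (edge (vertexPerm φ)) '' (ws.toFinset : Set (Cycle _)) := by
    ext c
    constructor
    · intro hc
      obtain ⟨C, rfl⟩ := exists_cycle_map_eq (f := edge (vertexPerm φ)) (C := c)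
        (fun e he => by rw [range_edge]; exact hc.2.2.1 e he)
      refine ⟨C, ?_, rfl⟩
      simp only [Finset.mem_coe, Multiset.mem_toFinset]
      exact h.mem_iff.2 ((isAlternatingCycle_map_iff φ C).1 hc)
    · rintro ⟨C, hC, rfl⟩
      simp only [Finset.mem_coe, Multiset.mem_toFinset] at hC
      exact (isAlternatingCycle_map_iff φ C).2 (h.mem_iff.1 hC)
  rw [numAltCycles, hset, Set.ncard_image_of_injective _ (cycle_map_injective (edge_injective _)),
    Set.ncard_coe_finset, Multiset.toFinset_card_of_nodup h.nodup_cycles]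

/-! ### Sums over conjugates in the group algebra -/

section GroupAlgebra

variable (G : Type*) [Group G]

/-- The group algebra of `G` over the real numbers. -/
abbrev GroupAlg := MonoidAlgebra ℝ G

variable {G}

/-- The element `g` of the group algebra. -/
noncomputable abbrev gp (g : G) : GroupAlg G := MonoidAlgebra.of ℝ G g

theorem mem_center_of_commute {z : GroupAlg G} (h : ∀ g : G, gp g * z = z * gp g) :
    z ∈ Subring.center (GroupAlg G) := by
  rw [Subring.mem_center_iff]
  intro x
  induction x using MonoidAlgebra.induction_on with
  | of g => exact h g
  | add x y hx hy => rw [add_mul, mul_add, hx, hy]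
  | smul r x hx => rw [smul_mul_assoc, mul_smul_comm, hx]

variable [Fintype G]

theorem conjSum_mem_center (g : G) :
    ∑ x : G, gp (x * g * x⁻¹) ∈ Subring.center (GroupAlg G) := by
  refine mem_center_of_commute fun y => ?_
  rw [Finset.mul_sum, Finset.sum_mul]
  refine Fintype.sum_equiv (Equiv.mulLeft y) _ _ fun x => ?_
  rw [← map_mul, ← map_mul]
  congr 1
  simp [mul_assoc]

/-- The sum of all conjugates `x g x⁻¹`, an element of the center of the group algebra. -/
noncomputable def conjSum (g : G) : Subring.center (GroupAlg G) :=
  ⟨∑ x : G, gp (x * g * x⁻¹), conjSum_mem_center g⟩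

theorem commSum_mem_center :
    ∑ a : G, ∑ b : G, gp (a * b * a⁻¹ * b⁻¹) ∈ Subring.center (GroupAlg G) := by
  refine mem_center_of_commute fun y => ?_
  simp only [Finset.mul_sum, Finset.sum_mul]
  refine Fintype.sum_equiv (MulAut.conj y).toEquiv _ _ fun a => ?_
  refine Fintype.sum_equiv (MulAut.conj y).toEquiv _ _ fun b => ?_
  rw [← map_mul, ← map_mul]
  congr 1
  simp [mul_assoc]

variable (G) in
/-- The sum of all commutators, an element of the center of the group algebra. -/
noncomputable def commSum : Subring.center (GroupAlg G) :=
  ⟨∑ a : G, ∑ b : G, gp (a * b * a⁻¹ * b⁻¹), commSum_mem_center⟩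

/-- Substitute `x * g` for the conjugating element. This invariance lets `conjSum` descend to cyclic
words. -/
theorem conjSum_mul_comm (g h : G) : conjSum (g * h) = conjSum (h * g) := by
  refine Subtype.ext (Fintype.sum_equiv (Equiv.mulRight g) _ _ fun x => ?_)
  congr 1
  simp [mul_assoc]

/-- With `x` the conjugating element, `x * t` and `x` run independently over the group and conjugate
`U` and `V` respectively. -/
theorem sum_conjSum_split (U V : G) :
    ∑ t : G, conjSum (t * U * t⁻¹ * V) = conjSum U * conjSum V := by
  apply Subtype.ext
  rw [AddSubmonoidClass.coe_finsetSum]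
  simp only [conjSum, Subring.coe_mul, Finset.mul_sum, Finset.sum_mul, ← map_mul]
  rw [Finset.sum_comm]
  refine Finset.sum_congr rfl fun x _ => ?_
  refine Fintype.sum_equiv (Equiv.mulLeft x) _ _ fun t => ?_
  congr 1
  simp [mul_assoc]

/-- By `sum_conjSum_split` read backwards, each summand is a sum over s of `conjSum` of the
commutator of s and t times `W`. The sum of all these commutators is central and can be pulled out
of the conjugation. -/
theorem sum_conjSum_mul_conjSum_inv (W : G) :
    ∑ t : G, conjSum t * conjSum (t⁻¹ * W) = commSum G * conjSum W := by
  simp only [← sum_conjSum_split]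
  apply Subtype.ext
  simp only [AddSubmonoidClass.coe_finsetSum, commSum, conjSum, Subring.coe_mul]
  have hc := Subring.mem_center_iff.1 (commSum_mem_center (G := G))
  simp only [map_mul] at hc ⊢
  have key : ∀ y : G, (∑ a : G, ∑ b : G, gp a * gp b * gp a⁻¹ * gp b⁻¹) *
      (gp y * gp W * gp y⁻¹) =
      ∑ a : G, ∑ b : G, gp y * (gp a * gp b * gp a⁻¹ * gp b⁻¹) * gp W * gp y⁻¹ := by
    intro y
    rw [← mul_assoc, ← mul_assoc, ← hc (gp y)]
    simp only [Finset.mul_sum, Finset.sum_mul]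
  rw [Finset.mul_sum]
  simp only [key]
  calc _ = ∑ a : G, ∑ b : G, ∑ y : G, gp y * (gp a * gp b * gp a⁻¹ * gp b⁻¹) * gp W * gp y⁻¹ := by
        rw [Finset.sum_comm]
        simp only [mul_assoc]
    _ = ∑ a : G, ∑ y : G, ∑ b : G, gp y * (gp a * gp b * gp a⁻¹ * gp b⁻¹) * gp W * gp y⁻¹ :=
        Finset.sum_congr rfl fun a _ => Finset.sum_comm
    _ = _ := Finset.sum_comm

theorem sum_conjSum_join (U V : G) :
    ∑ t : G, conjSum (t * U) * conjSum (t⁻¹ * V) = commSum G * conjSum (U * V) := by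
  rw [conjSum_mul_comm, ← sum_conjSum_mul_conjSum_inv]
  refine Fintype.sum_equiv (Equiv.mulRight U) _ _ fun t => ?_
  rw [Equiv.coe_mulRight, mul_inv_rev, mul_assoc U⁻¹, conjSum_mul_comm U⁻¹]
  simp [mul_assoc]

end GroupAlgebra

/-! ### Elimination of variables -/

section Elimination

variable {G : Type*} [Group G] [Fintype G]

/-- The sum of the conjugates of the product of the letters of a cyclic word. -/
noncomputable def cycleConjSum {D : Type*} (g : D → G) (C : Cycle D) :
    Subring.center (GroupAlg G) :=
  Quotient.liftOn C (fun l => conjSum (l.map g).prod) fun l l' (h : l ~r l') => by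
    obtain ⟨m, rfl⟩ := h
    induction m with
    | zero => simp
    | succ m ih =>
      rw [ih, ← List.rotate_rotate]
      cases l.rotate m with
      | nil => rfl
      | cons x L => simp [conjSum_mul_comm (g x)]

theorem cycleConjSum_coe {D : Type*} (g : D → G) (l : List D) :
    cycleConjSum g (l : Cycle D) = conjSum (l.map g).prod := rfl

theorem cycleConjSum_congr {D : Type*} {g g' : D → G} {C : Cycle D} (h : ∀ d ∈ C, g d = g' d) :
    cycleConjSum g C = cycleConjSum g' C := by
  induction C using Quotient.inductionOn' with
  | h l =>
    change conjSum (l.map g).prod = conjSum (l.map g').prod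
    rw [List.map_congr_left h]

/-- The letters `inl x` and `inr x` stand for `a x` and its inverse. -/
def letterValue {X : Type*} (a : X → G) : X ⊕ X → G := Sum.elim a fun x => (a x)⁻¹

omit [Fintype G] in
theorem letterValue_update_of_ne {X : Type*} [DecidableEq X] (a : X → G) {b : X} (t : G)
    {d : X ⊕ X} (h : d ≠ Sum.inl b) (h' : d ≠ Sum.inr b) :
    letterValue (Function.update a b t) d = letterValue a d := by
  rcases d with x | x <;> simp_all [letterValue]

omit [Fintype G] in
theorem prod_map_letterValue_update {X : Type*} [DecidableEq X] (a : X → G) {b : X} (t : G)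
    {U : List (X ⊕ X)} (h : Sum.inl b ∉ U) (h' : Sum.inr b ∉ U) :
    (U.map (letterValue (Function.update a b t))).prod = (U.map (letterValue a)).prod := by
  congr 1
  refine List.map_congr_left fun d hd => letterValue_update_of_ne a t ?_ ?_
  · rintro rfl; exact h hd
  · rintro rfl; exact h' hd

theorem prod_cycleConjSum_update {X : Type*} [DecidableEq X] (a : X → G) {b : X} (t : G)
    {ws : Multiset (Cycle (X ⊕ X))} (h : ∀ C ∈ ws, Sum.inl b ∉ C) (h' : ∀ C ∈ ws, Sum.inr b ∉ C) :
    (ws.map (cycleConjSum (letterValue (Function.update a b t)))).prod =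
      (ws.map (cycleConjSum (letterValue a))).prod := by
  congr 1
  refine Multiset.map_congr rfl fun C hC => cycleConjSum_congr fun d hd =>
    letterValue_update_of_ne a t ?_ ?_
  · rintro rfl; exact h C hC hd
  · rintro rfl; exact h' C hC hd

/-- Summation over the values of one letter splits a cyclic word or joins two of them. -/
theorem exists_eliminate_letter {X : Type*} [DecidableEq X] (b : X) {c : X ⊕ X → X ⊕ X}
    {ws : Multiset (Cycle (X ⊕ X))} (h : IsCycleDecomposition c ws) :
    ∃ (ws' : Multiset (Cycle (X ⊕ X))) (e : ℕ),
      IsCycleDecomposition (fun x => Equiv.swap (Sum.inl b) (Sum.inr b) (c x)) ws' ∧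
      Multiset.card ws' + 2 * e = Multiset.card ws + 1 ∧
      -- The letter `b` is not deleted from the new words; with value 1 it no longer affects their
      -- products.
      ∀ a : X → G, a b = 1 →
        ∑ t : G, (ws.map (cycleConjSum (letterValue (Function.update a b t)))).prod =
          commSum G ^ e * (ws'.map (cycleConjSum (letterValue a))).prod := by
  obtain ⟨C, hC, hbC⟩ := h.exists_mem (Sum.inl b)
  obtain ⟨ws₁, rfl⟩ := Multiset.exists_cons_of_mem hC
  obtain ⟨L, rfl⟩ := exists_cons_of_mem hbC
  by_cases hL : Sum.inr b ∈ L
  · obtain ⟨U, V, rfl⟩ := List.append_of_mem hL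
    refine ⟨_, 0, h.split, by simp, fun a ha => ?_⟩
    have hn := h.nodup
    simp only [Multiset.cons_bind, Cycle.coe_toMultiset, Multiset.nodup_add, Multiset.coe_nodup,
      Multiset.disjoint_left, Multiset.mem_coe, Multiset.mem_bind, not_exists, not_and,
      mem_toMultiset, List.nodup_cons, List.nodup_append, List.mem_append, List.mem_cons,
      not_or] at hn
    obtain ⟨⟨⟨hbU, -, hbV⟩, -, ⟨hbV', -⟩, hU⟩, -, h3⟩ := hn
    have hbU' : Sum.inr b ∉ U := fun hm => hU _ hm _ (Or.inl rfl) rfl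
    have h1 := fun C (hC : C ∈ ws₁) => h3 (a := Sum.inl b) (Or.inl rfl) C hC
    have h2 := fun C (hC : C ∈ ws₁) => h3 (a := Sum.inr b) (Or.inr (Or.inr (Or.inl rfl))) C hC
    simp only [Multiset.map_cons, Multiset.prod_cons, prod_cycleConjSum_update a _ h1 h2,
      cycleConjSum_coe, List.map_cons, List.map_append, List.prod_cons, List.prod_append,
      prod_map_letterValue_update a _ hbU hbU', prod_map_letterValue_update a _ hbV hbV']
    rw [← Finset.sum_mul]
    have : letterValue a (Sum.inl b) = 1 := ha
    have : letterValue a (Sum.inr b) = 1 := by simp [letterValue, ha]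
    have hl : ∀ t, letterValue (Function.update a b t) (Sum.inl b) = t := by simp [letterValue]
    have hr : ∀ t, letterValue (Function.update a b t) (Sum.inr b) = t⁻¹ := by simp [letterValue]
    simp only [*, one_mul, pow_zero]
    rw [← mul_assoc, ← sum_conjSum_split]
    simp only [mul_assoc]
  · obtain ⟨C', hC', hbC'⟩ := h.exists_mem (Sum.inr b)
    have hC'₁ : C' ∈ ws₁ := by
      rcases Multiset.mem_cons.1 hC' with rfl | hC'
      · simp at hbC'; exact absurd hbC' hL
      · exact hC'
    obtain ⟨ws₂, rfl⟩ := Multiset.exists_cons_of_mem hC'₁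
    obtain ⟨V, rfl⟩ := exists_cons_of_mem hbC'
    refine ⟨_, 1, h.join, by simp, fun a ha => ?_⟩
    have hn := h.nodup
    simp only [Multiset.cons_bind, Cycle.coe_toMultiset, Multiset.nodup_add, Multiset.coe_nodup,
      Multiset.disjoint_left, Multiset.mem_coe, Multiset.mem_bind, not_exists, not_and,
      mem_toMultiset, List.nodup_cons, List.mem_cons, Multiset.mem_add, not_or] at hn
    obtain ⟨⟨hbU, -⟩, ⟨⟨hbV', -⟩, -, h3⟩, h4⟩ := hn
    have h5 := h4 (a := Sum.inl b) (Or.inl rfl)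
    have h2 := fun C (hC : C ∈ ws₂) => h3 (a := Sum.inr b) (Or.inl rfl) C hC
    simp only [Multiset.map_cons, Multiset.prod_cons, prod_cycleConjSum_update a _ h5.2 h2,
      cycleConjSum_coe, List.map_cons, List.map_append, List.prod_cons, List.prod_append,
      prod_map_letterValue_update a _ hbU hL, prod_map_letterValue_update a _ h5.1.2 hbV']
    have : letterValue a (Sum.inl b) = 1 := ha
    have : letterValue a (Sum.inr b) = 1 := by simp [letterValue, ha]
    have hl : ∀ t, letterValue (Function.update a b t) (Sum.inl b) = t := by simp [letterValue]
    have hr : ∀ t, letterValue (Function.update a b t) (Sum.inr b) = t⁻¹ := by simp [letterValue]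
    simp only [*, one_mul, pow_one, ← mul_assoc]
    rw [← Finset.sum_mul, sum_conjSum_join]

/-- The functions with value `1` outside of `T`. -/
def supportedOn {X : Type*} [Fintype X] [DecidableEq X] (G : Type*) [Group G] [Fintype G]
    [DecidableEq G] (T : Finset X) : Finset (X → G) :=
  Finset.univ.filter fun a => ∀ x ∉ T, a x = 1

theorem sum_supportedOn_insert {X M : Type*} [Fintype X] [DecidableEq X] [DecidableEq G]
    [AddCommMonoid M] {T : Finset X} {b : X} (hb : b ∉ T) (F : (X → G) → M) :
    ∑ a ∈ supportedOn G (insert b T), F a =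
      ∑ a ∈ supportedOn G T, ∑ t : G, F (Function.update a b t) := by
  rw [← Finset.sum_product']
  refine Finset.sum_bij' (fun a _ => (Function.update a b 1, a b))
    (fun p _ => Function.update p.1 b p.2) ?_ ?_ ?_ ?_ ?_
  · intro a ha
    simp only [supportedOn, Finset.mem_filter, Finset.mem_univ, true_and, Finset.mem_insert,
      not_or, Finset.mem_product, and_true] at ha ⊢
    intro x hx
    by_cases hxb : x = b
    · simp [hxb]
    · simp [hxb, ha x ⟨hxb, hx⟩]
  · rintro ⟨a, t⟩ ha
    simp only [supportedOn, Finset.mem_filter, Finset.mem_univ, true_and, Finset.mem_insert,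
      not_or, Finset.mem_product, and_true] at ha ⊢
    rintro x ⟨hxb, hx⟩
    simp [hxb, ha x hx]
  · intro a _
    simp
  · rintro ⟨a, t⟩ ha
    simp only [supportedOn, Finset.mem_filter, Finset.mem_univ, true_and,
      Finset.mem_product, and_true] at ha
    simp [← ha b hb]
  · intro a _
    simp

/-- The map that exchanges `inl x` and `inr x` for `x ∈ T`. -/
def flipOn {X : Type*} [DecidableEq X] (T : Finset X) : X ⊕ X → X ⊕ X
  | Sum.inl x => if x ∈ T then Sum.inr x else Sum.inl x
  | Sum.inr x => if x ∈ T then Sum.inl x else Sum.inr x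

theorem flipOn_insert {X : Type*} [DecidableEq X] {T : Finset X} {b : X} (hb : b ∉ T)
    (d : X ⊕ X) :
    flipOn (insert b T) d = flipOn T (Equiv.swap (Sum.inl b) (Sum.inr b) d) := by
  rcases d with x | x <;> by_cases hx : x = b
  · subst hx; simp [flipOn, hb]
  · rw [Equiv.swap_apply_of_ne_of_ne (by simpa using hx) (by simp)]
    simp [flipOn, hx]
  · subst hx; simp [flipOn, hb]
  · rw [Equiv.swap_apply_of_ne_of_ne (by simp) (by simpa using hx)]
    simp [flipOn, hx]

theorem conjSum_one : conjSum (1 : G) = (Fintype.card G : Subring.center (GroupAlg G)) := by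
  apply Subtype.ext
  simp [conjSum, MonoidAlgebra.natCast_def]

theorem cycleConjSum_letterValue_one {X : Type*} (C : Cycle (X ⊕ X)) :
    cycleConjSum (letterValue (1 : X → G)) C = Fintype.card G := by
  rw [← conjSum_one]
  induction C using Quotient.inductionOn' with
  | h l =>
    change conjSum (l.map _).prod = _
    rw [List.prod_eq_one]
    rintro g hg
    obtain ⟨x | x, -, rfl⟩ := List.mem_map.1 hg <;> simp [letterValue]

/-- Summation over the values of all letters of `T`. -/
theorem exists_eliminate_letters {X : Type*} [Fintype X] [DecidableEq X] [DecidableEq G]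
    (T : Finset X) : ∀ {c : X ⊕ X → X ⊕ X} {ws : Multiset (Cycle (X ⊕ X))},
      IsCycleDecomposition c ws →
    ∃ (ws' : Multiset (Cycle (X ⊕ X))) (h : ℕ),
      IsCycleDecomposition (fun x => flipOn T (c x)) ws' ∧
      Multiset.card ws' + 2 * h = Multiset.card ws + T.card ∧
      ∑ a ∈ supportedOn G T, (ws.map (cycleConjSum (letterValue a))).prod =
        commSum G ^ h * (Fintype.card G : Subring.center (GroupAlg G)) ^ Multiset.card ws' := by
  induction T using Finset.induction_on with
  | empty =>
    intro c ws hws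
    refine ⟨ws, 0, ?_, by simp, ?_⟩
    · convert hws using 2 with x
      rcases c x with y | y <;> simp [flipOn]
    · have : supportedOn G (∅ : Finset X) = {1} := by
        ext a; simp [supportedOn, funext_iff]
      rw [this, Finset.sum_singleton, pow_zero, one_mul, Multiset.map_congr rfl
        (fun C _ => cycleConjSum_letterValue_one C)]
      simp
  | insert b T hb ih =>
    intro c ws hws
    obtain ⟨ws₁, e, h1, h2, h3⟩ := exists_eliminate_letter (G := G) b hws
    obtain ⟨ws', h, h4, h5, h6⟩ := ih h1
    refine ⟨ws', e + h, ?_, ?_, ?_⟩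
    · simpa only [flipOn_insert hb] using h4
    · rw [Finset.card_insert_of_notMem hb]; omega
    · rw [sum_supportedOn_insert hb, pow_add, mul_assoc, ← h6, Finset.mul_sum]
      refine Finset.sum_congr rfl fun a ha => h3 a ?_
      simp only [supportedOn, Finset.mem_filter] at ha
      exact ha.2 b hb

end Elimination

/-! ### The number of solutions of a permutation equality -/

theorem chain_ofFn {D : Type*} {n : ℕ} {c : D → D} {f : Fin (n + 1) → D}
    (h : ∀ i, c (f i) = f (i + 1)) :
    Cycle.Chain (fun x y => c x = y) (List.ofFn f : Cycle D) := by
  rw [List.ofFn_succ, Cycle.chain_coe_cons]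
  -- The closed-up list is `f` at 0, …, n + 1 reduced modulo n + 1, so the wrap-around becomes an
  -- ordinary step.
  have : f 0 :: ((List.ofFn fun i : Fin n => f i.succ) ++ [f 0]) =
      List.ofFn fun i : Fin (n + 2) => f (Fin.ofNat (n + 1) i) := by
    rw [List.ofFn_succ_last, ← List.cons_append, ← List.ofFn_succ]
    simp only [Fin.ofNat, Fin.val_castSucc, Fin.val_last, Nat.mod_self]
    congr 2
    refine funext fun i => congrArg f (Fin.ext ?_)
    exact (Nat.mod_eq_of_lt i.2).symm
  rw [this, List.isChain_ofFn]
  intro i hi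
  rw [h]
  congr 1
  ext
  simp [Fin.ofNat, Fin.val_add]

theorem neg_succ_eq {n : ℕ} (i : Fin n) : -(i.succ) = (Fin.rev i).succ := by
  rw [neg_eq_iff_add_eq_zero]
  ext
  have := i.2
  simp only [Fin.val_add, Fin.val_succ, Fin.val_rev, Fin.val_zero]
  rw [show (i : ℕ) + 1 + (n - (i + 1) + 1) = n + 1 by omega, Nat.mod_self]

/-- The cyclic sequences of the grey and of the black edges. -/
theorem isCycleDecomposition_colours {n : ℕ} (s : Equiv.Perm (Fin (n + 1))) :
    IsCycleDecomposition
      (Sum.map (fun x => x + 1) (fun x => s (s.symm x - 1)) :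
        Fin (n + 1) ⊕ Fin (n + 1) → Fin (n + 1) ⊕ Fin (n + 1))
      (((List.ofFn Sum.inl : List (Fin (n + 1) ⊕ Fin (n + 1))) : Cycle _) ::ₘ
        -- Black edges lower the position, hence the index `-i`; the list starts at position 0, that
        -- is, at `s 0`.
        ((List.ofFn fun i => Sum.inr (s (-i)) : List (Fin (n + 1) ⊕ Fin (n + 1))) : Cycle _) ::ₘ
        0) := by
  refine ⟨?_, ?_, ?_, ?_⟩
  · simp only [Multiset.cons_bind, Cycle.coe_toMultiset, Multiset.zero_bind, add_zero,
      Multiset.nodup_add, Multiset.coe_nodup, List.nodup_ofFn, Multiset.disjoint_left]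
    refine ⟨Sum.inl_injective, fun i j h => by simpa using h, fun {d} h => ?_⟩
    simp only [Multiset.mem_coe, List.mem_ofFn] at h ⊢
    obtain ⟨i, rfl⟩ := h
    simp
  · rintro (x | x)
    · exact ⟨_, Multiset.mem_cons_self _ _, List.mem_ofFn.2 ⟨x, rfl⟩⟩
    · refine ⟨_, Multiset.mem_cons_of_mem (Multiset.mem_cons_self _ _), ?_⟩
      rw [Cycle.mem_coe_iff, List.mem_ofFn]
      exact ⟨-s.symm x, by simp⟩
  · intro C hC
    simp only [Multiset.mem_cons, Multiset.notMem_zero, or_false] at hC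
    rcases hC with rfl | rfl <;> simp
  · intro C hC
    simp only [Multiset.mem_cons, Multiset.notMem_zero, or_false] at hC
    rcases hC with rfl | rfl
    · exact chain_ofFn fun i => rfl
    · refine chain_ofFn fun i => ?_
      simp [sub_eq_add_neg, add_comm]

section Solutions

variable {G : Type*} [Group G] [Fintype G]

variable (G) in
/-- The coefficient of `1` in the `h`-th power of the sum of all commutators. -/
noncomputable def commCount (h : ℕ) : ℝ :=
  ((commSum G ^ h : Subring.center (GroupAlg G)) : GroupAlg G).coeff 1

/-- A conjugate of `g` is 1 only if `g` is. Summed over all assignments, this coefficient counts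
solutions, each with weight |G|. -/
theorem coeff_conjSum_one [DecidableEq G] (g : G) :
    (conjSum g : GroupAlg G).coeff 1 = if g = 1 then (Fintype.card G : ℝ) else 0 := by
  simp only [conjSum, MonoidAlgebra.coeff_sum]
  rw [Finsupp.finsetSum_apply]
  have : ∀ x : G, (gp (x * g * x⁻¹)).coeff 1 = if g = 1 then (1 : ℝ) else 0 := by
    intro x
    rw [gp, MonoidAlgebra.of_apply, MonoidAlgebra.coeff_single, Finsupp.single_apply]
    simp
  simp only [this]
  split_ifs <;> simp

omit [Fintype G] in
theorem prod_letterValue_word {n : ℕ} (φ : Equiv.Perm (Fin n)) (a : Fin n → G) :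
    (((List.ofFn Sum.inl ++ List.ofFn fun i => Sum.inr (vertexPerm φ (-i))).map
      (letterValue (Fin.cons 1 a : Fin (n + 1) → G)))).prod =
      (List.ofFn a).prod * (List.ofFn fun i => a (φ i)).prod⁻¹ := by
  rw [List.map_append, List.prod_append, List.map_ofFn, List.map_ofFn, List.ofFn_succ,
    List.ofFn_succ, List.prod_inv_reverse]
  have : (List.map (fun x => x⁻¹) (List.ofFn fun i => a (φ i))).reverse =
      List.ofFn fun i => (a (φ (Fin.rev i)))⁻¹ := by
    rw [List.map_ofFn]
    refine List.ext_getElem (by simp) fun i h1 h2 => ?_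
    simp only [List.getElem_reverse, List.getElem_ofFn, Function.comp_apply, List.length_ofFn]
    congr 3
    ext
    simp [Fin.val_rev]
    omega
  rw [this]
  simp [letterValue, neg_succ_eq]

theorem sum_supportedOn_erase_zero {M : Type*} [AddCommMonoid M] [DecidableEq G] {n : ℕ}
    (F : (Fin (n + 1) → G) → M) :
    ∑ a ∈ supportedOn G (Finset.univ.erase (0 : Fin (n + 1))), F a =
      ∑ a : Fin n → G, F (Fin.cons 1 a) := by
  symm
  refine Finset.sum_bij (fun a _ => Fin.cons 1 a) ?_ ?_ ?_ ?_
  · intro a _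
    simp [supportedOn]
  · intro a _ b _ h
    exact (Fin.cons_injective2 h).2
  · intro a ha
    simp only [supportedOn, Finset.mem_filter, Finset.mem_erase, Finset.mem_univ, true_and,
      and_true, not_not, forall_eq] at ha
    exact ⟨Fin.tail a, Finset.mem_univ _, by rw [← ha]; exact Fin.cons_self_tail a⟩
  · intro a _
    rfl

/-- The number of solutions in terms of the alternating cycles. -/
theorem exists_permProb_eq {n : ℕ} (φ : Equiv.Perm (Fin n)) :
    ∃ h : ℕ, numAltCycles φ + 2 * h = n + 1 ∧
      (∃ ws, IsCycleDecomposition (nextEdge (vertexPerm φ)) ws) ∧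
      (permProb G φ : ℝ) = commCount G h / (Fintype.card G : ℝ) ^ (2 * h) := by
  classical
  -- Both monochromatic cycles are listed from vertex 0, so joining them there gives the single
  -- initial word.
  have h0 := isCycleDecomposition_colours (vertexPerm φ)
  rw [List.ofFn_succ, List.ofFn_succ (f := fun i => Sum.inr _), neg_zero, vertexPerm_zero] at h0
  obtain ⟨ws, h, h1, h2, h3⟩ := exists_eliminate_letters (G := G) (Finset.univ.erase 0) h0.join
  -- The join at 0 and the eliminations at the other vertices together flip the colour everywhere,
  -- which turns the successor of the same colour into the alternating one.
  have hc : (fun x => flipOn (Finset.univ.erase 0) (Equiv.swap (Sum.inl 0) (Sum.inr 0)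
      (Sum.map (fun x => x + 1) (fun x => vertexPerm φ ((vertexPerm φ).symm x - 1)) x))) =
      nextEdge (vertexPerm φ) := by
    funext x
    rw [← flipOn_insert (Finset.notMem_erase _ _), Finset.insert_erase (Finset.mem_univ _)]
    rcases x with x | x <;> simp [flipOn, nextEdge]
  rw [hc] at h1
  rw [← numAltCycles_eq_card h1] at h2 h3
  have hcard : numAltCycles φ + 2 * h = n + 1 := by
    simp at h2; omega
  refine ⟨h, hcard, ⟨ws, h1⟩, ?_⟩
  have hzero : (Sum.inr 0 : Fin (n + 1) ⊕ Fin (n + 1)) = Sum.inr (vertexPerm φ (-0)) := by simp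
  rw [hzero, ← List.ofFn_succ (f := fun i => Sum.inr (vertexPerm φ (-i))), ← List.ofFn_succ,
    sum_supportedOn_erase_zero] at h3
  simp only [Multiset.map_cons, Multiset.map_zero, Multiset.prod_cons, Multiset.prod_zero, mul_one,
    cycleConjSum_coe, prod_letterValue_word] at h3
  have h4 := congrArg (fun z : Subring.center (GroupAlg G) => (z : GroupAlg G).coeff 1) h3
  have hr : ((commSum G ^ h * (Fintype.card G : Subring.center (GroupAlg G)) ^ numAltCycles φ :
      Subring.center (GroupAlg G)) : GroupAlg G).coeff 1 =
      commCount G h * (Fintype.card G : ℝ) ^ numAltCycles φ := by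
    rw [commCount, ← Nat.cast_pow, ← nsmul_eq_mul', AddSubmonoidClass.coe_nsmul]
    rw [MonoidAlgebra.coeff_smul, Finsupp.smul_apply, nsmul_eq_mul, mul_comm, Nat.cast_pow]
  simp only [hr, AddSubmonoidClass.coe_finsetSum, MonoidAlgebra.coeff_sum,
    Finsupp.finsetSum_apply, coeff_conjSum_one, mul_inv_eq_one] at h4
  rw [← Finset.sum_filter, Finset.sum_const, nsmul_eq_mul] at h4
  have hG : (Fintype.card G : ℝ) ≠ 0 := by simp
  rw [permProb, prob]
  push_cast
  rw [Nat.card_eq_fintype_card, Nat.card_eq_fintype_card, Fintype.card_subtype,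
    div_eq_div_iff (by positivity) (by positivity)]
  apply mul_right_cancel₀ hG
  rw [mul_right_comm, h4, mul_right_comm, mul_assoc, mul_assoc, ← pow_add, add_comm (2 * h), hcard,
    pow_succ]

end Solutions

/-! ### Strict monotonicity -/

section Strict

variable {G : Type*} [Group G] [Fintype G]

open Matrix

variable (G) in
/-- The matrix of the multiplication with the sum of all commutators. -/
noncomputable def commMatrix : Matrix G G ℝ :=
  Matrix.of fun x y => (commSum G : GroupAlg G).coeff (x * y⁻¹)

variable (G) in
/-- The entry at `(t, r)`, `y` counts the elements that conjugate `y t` to `r`. -/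
noncomputable def conjMatrix [DecidableEq G] : Matrix (G × G) G ℝ :=
  Matrix.of fun p y => ∑ c : G, if c * (y * p.1) * c⁻¹ = p.2 then 1 else 0

theorem coeff_commSum [DecidableEq G] (z : G) :
    (commSum G : GroupAlg G).coeff z =
      ∑ a : G, ∑ b : G, if a * b * a⁻¹ * b⁻¹ = z then (1 : ℝ) else 0 := by
  simp only [commSum, MonoidAlgebra.coeff_sum, Finsupp.finsetSum_apply, gp,
    MonoidAlgebra.of_apply, MonoidAlgebra.coeff_single, Finsupp.single_apply]

/-- An entry counts the triples with `c * (x * t) * c⁻¹ = d * (y * t) * d⁻¹`. With `b = y * t` and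
`a = c⁻¹ * d` this says that the commutator of `a` and `b` is `x * y⁻¹`, and `c` stays free. -/
theorem conjTranspose_mul_conjMatrix [DecidableEq G] :
    (conjMatrix G)ᴴ * conjMatrix G = (Fintype.card G : ℝ) • commMatrix G := by
  ext x y
  simp only [Matrix.mul_apply, Matrix.conjTranspose_apply, conjMatrix, Matrix.of_apply, star_trivial,
    Fintype.sum_prod_type, Matrix.smul_apply, commMatrix, coeff_commSum, smul_eq_mul]
  simp only [Finset.sum_mul_sum]
  calc _ = ∑ t : G, ∑ c : G, ∑ d : G,
        if c * (x * t) * c⁻¹ = d * (y * t) * d⁻¹ then (1 : ℝ) else 0 := by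
        refine Finset.sum_congr rfl fun t _ => ?_
        rw [Finset.sum_comm]
        refine Finset.sum_congr rfl fun c _ => ?_
        rw [Finset.sum_comm]
        refine Finset.sum_congr rfl fun d _ => ?_
        simp [eq_comm]
    _ = ∑ c : G, ∑ t : G, ∑ d : G,
        if c * (x * t) * c⁻¹ = d * (y * t) * d⁻¹ then (1 : ℝ) else 0 := Finset.sum_comm
    _ = ∑ c : G, ∑ b : G, ∑ a : G, if a * b * a⁻¹ * b⁻¹ = x * y⁻¹ then (1 : ℝ) else 0 := by
        refine Finset.sum_congr rfl fun c _ => ?_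
        refine Fintype.sum_equiv (Equiv.mulLeft y) _ _ fun t => ?_
        refine Fintype.sum_equiv (Equiv.mulLeft c⁻¹) _ _ fun d => ?_
        congr 1
        rw [eq_iff_iff]
        simp only [Equiv.coe_mulLeft]
        constructor
        · intro h
          have : x = c⁻¹ * (d * (y * t) * d⁻¹) * c * t⁻¹ := by rw [← h]; group
          rw [this]; group
        · intro h
          have : x = c⁻¹ * d * (y * t) * (c⁻¹ * d)⁻¹ * (y * t)⁻¹ * y := by rw [h]; group
          rw [this]; group
    _ = ∑ c : G, ∑ a : G, ∑ b : G, if a * b * a⁻¹ * b⁻¹ = x * y⁻¹ then (1 : ℝ) else 0 :=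
        Finset.sum_congr rfl fun c _ => Finset.sum_comm
    _ = _ := by simp

/-- Only 1 is conjugate to 1, so the row `(x⁻¹, 1)` isolates the coordinate at `x`. -/
theorem conjMatrix_mulVec_injective [DecidableEq G] :
    Function.Injective (conjMatrix G).mulVec := by
  have h : ∀ (v : G → ℝ) (x : G), (conjMatrix G *ᵥ v) (x⁻¹, 1) = Fintype.card G * v x := by
    intro v x
    have : ∀ y c : G, c * (y * x⁻¹) * c⁻¹ = 1 ↔ y = x := by
      intro y c
      rw [conj_eq_one_iff, mul_inv_eq_one]
    simp [Matrix.mulVec, dotProduct, conjMatrix, this, apply_ite Finset.card,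
      apply_ite (Nat.cast (R := ℝ))]
  intro v w hvw
  funext x
  have := congrFun hvw (x⁻¹, 1)
  rw [h, h] at this
  exact mul_left_cancel₀ (by simp) this

theorem commMatrix_posDef : (commMatrix G).PosDef := by
  classical
  have h : ((conjMatrix G)ᴴ * conjMatrix G).PosDef :=
    Matrix.PosDef.conjTranspose_mul_self _ conjMatrix_mulVec_injective
  have hG : (0 : ℝ) < (Fintype.card G : ℝ)⁻¹ := by positivity
  rw [conjTranspose_mul_conjMatrix] at h
  have := h.smul hG
  rwa [smul_smul, inv_mul_cancel₀ (by simp), one_smul] at this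

theorem commMatrix_pow_posDef [DecidableEq G] : ∀ h : ℕ, (commMatrix G ^ h).PosDef
  | 0 => by rw [pow_zero]; exact Matrix.PosDef.one
  | 1 => by rw [pow_one]; exact commMatrix_posDef
  -- Congruence of the `h`-th power by the invertible Hermitian matrix raises the exponent by two,
  -- hence the two base cases.
  | h + 2 => by
    have hK := commMatrix_posDef (G := G)
    have := (commMatrix_pow_posDef h).mul_mul_conjTranspose_same (B := commMatrix G)
      (Matrix.vecMul_injective_iff_isUnit.2 hK.isUnit)
    rwa [hK.isHermitian.eq, ← pow_succ', ← pow_succ] at this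

theorem commMatrix_pow_apply [DecidableEq G] (h : ℕ) (x y : G) :
    (commMatrix G ^ h) x y =
      ((commSum G ^ h : Subring.center (GroupAlg G)) : GroupAlg G).coeff (x * y⁻¹) := by
  induction h generalizing x with
  | zero =>
    rw [pow_zero, pow_zero, Matrix.one_apply, Subring.coe_one, MonoidAlgebra.one_def,
      MonoidAlgebra.coeff_single]
    simp [Finsupp.single_apply, eq_comm, mul_inv_eq_one]
  | succ h ih =>
    rw [pow_succ', pow_succ', Matrix.mul_apply, Subring.coe_mul, MonoidAlgebra.coeff_mul_apply_left,
      Finsupp.sum_fintype _ _ (by simp)]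
    refine Fintype.sum_equiv ((Equiv.inv G).trans (Equiv.mulLeft x)) _ _ fun z => ?_
    rw [ih]
    simp [commMatrix]

/-- Evaluate the positive definite form on the difference of the basis vectors at `z` and 1: by
symmetry it is twice the difference of the two coefficients. -/
theorem coeff_commSum_pow_lt (h : ℕ) {z : G} (hz : z ≠ 1) :
    ((commSum G ^ h : Subring.center (GroupAlg G)) : GroupAlg G).coeff z < commCount G h := by
  classical
  have hp := commMatrix_pow_posDef (G := G) h
  have hv : (Pi.single z 1 - Pi.single 1 1 : G → ℝ) ≠ 0 := by
    intro h0
    have := congrFun h0 z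
    simp [hz] at this
  have hpos := hp.dotProduct_mulVec_pos hv
  have hsymm : (commMatrix G ^ h) 1 z = (commMatrix G ^ h) z 1 := by
    simpa using hp.isHermitian.apply z 1
  have : star (Pi.single z 1 - Pi.single 1 1 : G → ℝ) ⬝ᵥ
      ((commMatrix G ^ h) *ᵥ (Pi.single z 1 - Pi.single 1 1)) =
      (commMatrix G ^ h) z z - (commMatrix G ^ h) z 1 - (commMatrix G ^ h) 1 z +
        (commMatrix G ^ h) 1 1 := by
    simp [Matrix.mulVec_sub, sub_dotProduct]
    ring
  rw [this, hsymm] at hpos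
  simp only [commMatrix_pow_apply, mul_inv_cancel, inv_one, mul_one] at hpos
  rw [commCount]
  linarith

/-- Expanding one factor `commSum` gives |G|² coefficients of `commSum ^ h`, none above the one at
1, and strictly below it at a nontrivial commutator. -/
theorem commCount_succ_lt (hG : ¬ ∀ a b : G, a * b = b * a) (h : ℕ) :
    commCount G (h + 1) < (Fintype.card G : ℝ) ^ 2 * commCount G h := by
  classical
  push Not at hG
  obtain ⟨a, b, hab⟩ := hG
  have hz : a * b * a⁻¹ * b⁻¹ ≠ 1 := by
    intro h1
    rw [mul_inv_eq_one, mul_inv_eq_iff_eq_mul] at h1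
    exact hab h1
  have hsum : commCount G (h + 1) = ∑ a : G, ∑ b : G,
      ((commSum G ^ h : Subring.center (GroupAlg G)) : GroupAlg G).coeff
        (a * b * a⁻¹ * b⁻¹)⁻¹ := by
    rw [commCount, pow_succ', Subring.coe_mul, commSum]
    simp only [Finset.sum_mul, MonoidAlgebra.coeff_sum, Finsupp.finsetSum_apply, gp,
      MonoidAlgebra.of_apply, MonoidAlgebra.coeff_single_mul_apply, one_mul, mul_one]
  have hle : ∀ z : G,
      ((commSum G ^ h : Subring.center (GroupAlg G)) : GroupAlg G).coeff z ≤ commCount G h := by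
    intro z
    by_cases h1 : z = 1
    · rw [h1, commCount]
    · exact (coeff_commSum_pow_lt h h1).le
  calc _ < ∑ _a : G, ∑ _b : G, commCount G h := by
        rw [hsum]
        refine Finset.sum_lt_sum (fun a _ => Finset.sum_le_sum fun b _ => hle _)
          ⟨a, Finset.mem_univ _, Finset.sum_lt_sum (fun b _ => hle _)
            ⟨b, Finset.mem_univ _, coeff_commSum_pow_lt h (inv_ne_one.2 hz)⟩⟩
    _ = _ := by simp; ring

variable (G) in
/-- The probability that a product of `h` commutators of random elements is `1`. -/
noncomputable def commProb (h : ℕ) : ℝ := commCount G h / (Fintype.card G : ℝ) ^ (2 * h)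

theorem commProb_strictAnti (hG : ¬ ∀ a b : G, a * b = b * a) : StrictAnti (commProb G) := by
  refine strictAnti_nat_of_succ_lt fun h => ?_
  have := commCount_succ_lt hG h
  rw [commProb, commProb, div_lt_div_iff₀ (by positivity) (by positivity), mul_add, pow_add]
  have hc : (0 : ℝ) < (Fintype.card G : ℝ) ^ (2 * h) := by positivity
  refine (mul_lt_mul_of_pos_right this hc).trans_eq ?_
  rw [mul_one]
  ring

theorem commProb_zero : commProb G 0 = 1 := by
  simp [commProb, commCount]

end Strict

/-! ### Permutation probabilities as commutator probabilities. -/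

theorem permProb_eq_commProb {G : Type*} [Group G] [Fintype G] {n h : ℕ} {φ : Equiv.Perm (Fin n)}
    (hh : numAltCycles φ + 2 * h = n + 1) : (permProb G φ : ℝ) = commProb G h := by
  obtain ⟨h', h1, -, h2⟩ := exists_permProb_eq (G := G) φ
  obtain rfl : h = h' := by omega
  exact h2

theorem exists_isCycleDecomposition {n : ℕ} (φ : Equiv.Perm (Fin n)) :
    ∃ ws, IsCycleDecomposition (nextEdge (vertexPerm φ)) ws := by
  -- The decomposition does not involve the group, so the trivial one serves.
  obtain ⟨-, -, h, -⟩ := exists_permProb_eq (G := Multiplicative (ZMod 1)) φ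
  exact h

theorem exists_numAltCycles_add {n : ℕ} (φ : Equiv.Perm (Fin n)) :
    ∃ h, numAltCycles φ + 2 * h = n + 1 := by
  obtain ⟨h, hh, -⟩ := exists_permProb_eq (G := Multiplicative (ZMod 1)) φ
  exact ⟨h, hh⟩

/-! ### The order-reversing permutation -/

theorem vertexPerm_revPerm {n : ℕ} (x : Fin (n + 1)) :
    vertexPerm (Fin.revPerm : Equiv.Perm (Fin n)) x = -x := by
  cases x using Fin.cases with
  | zero => simp
  | succ i => rw [vertexPerm_succ, neg_succ_eq, Fin.revPerm_apply]

/-- Here the vertex permutation is negation, so every edge, of either colour, leads from `x` to `x +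
1`. The vertex count 2g + 1 is odd, so the walk changes colour after one turn and covers all edges
in two. -/
theorem numAltCycles_revPerm (g : ℕ) :
    numAltCycles (Fin.revPerm : Equiv.Perm (Fin (2 * g))) = 1 := by
  obtain ⟨ws, hws⟩ := exists_isCycleDecomposition (Fin.revPerm : Equiv.Perm (Fin (2 * g)))
  rw [numAltCycles_eq_card hws]
  obtain ⟨C, hC, h0⟩ := hws.exists_mem (Sum.inl 0)
  have hsymm : ∀ x : Fin (2 * g + 1),
      (vertexPerm (Fin.revPerm : Equiv.Perm (Fin (2 * g)))).symm x = -x := by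
    intro x
    rw [Equiv.symm_apply_eq, vertexPerm_revPerm, neg_neg]
  have hsucc : ∀ m : ℕ, Fin.ofNat (2 * g + 1) m + 1 = Fin.ofNat (2 * g + 1) (m + 1) := by
    intro m
    ext
    simp [Fin.val_add]
  have hstep : ∀ m : ℕ, (Even m → Sum.inl (Fin.ofNat (2 * g + 1) m) ∈ C) ∧
      (Odd m → Sum.inr (Fin.ofNat (2 * g + 1) m) ∈ C) := by
    intro m
    induction m with
    | zero => exact ⟨fun _ => h0, by simp⟩
    | succ m ih =>
      constructor
      · intro hm
        have := apply_mem_of_chain (hws.chain C hC) (ih.2 (by simpa [parity_simps] using hm))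
        rw [nextEdge, hsymm, vertexPerm_revPerm] at this
        rw [← hsucc]
        convert this using 2
        abel
      · intro hm
        have := apply_mem_of_chain (hws.chain C hC) (ih.1 (by simpa [parity_simps] using hm))
        rwa [nextEdge, hsucc] at this
  have hval : ∀ x : Fin (2 * g + 1), Fin.ofNat (2 * g + 1) x = x ∧
      Fin.ofNat (2 * g + 1) (x + (2 * g + 1)) = x := by
    intro x
    constructor <;> ext <;> simp [Fin.ofNat, Nat.mod_eq_of_lt x.2]
  have hodd : ∀ m : ℕ, ¬ Even m → Even (m + (2 * g + 1)) := by
    intro m hm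
    simpa [parity_simps] using hm
  have hall : ∀ d, d ∈ C := by
    rintro (x | x) <;> by_cases hx : Even (x : ℕ)
    · have := (hstep x).1 hx
      rwa [(hval x).1] at this
    · have := (hstep _).1 (hodd x hx)
      rwa [(hval x).2] at this
    · have := (hstep (x + (2 * g + 1))).2 (by
        rw [← Nat.not_even_iff_odd]; simpa [parity_simps] using hx)
      rwa [(hval x).2] at this
    · have := (hstep x).2 (Nat.not_even_iff_odd.1 hx)
      rwa [(hval x).1] at this
  obtain ⟨t, rfl⟩ := Multiset.exists_cons_of_mem hC
  have ht : t = 0 := by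
    refine Multiset.eq_zero_of_forall_notMem fun C' hC' => ?_
    have hC'' := Multiset.mem_cons_of_mem (b := C) hC'
    obtain ⟨d, hd⟩ := exists_mem_of_ne_nil (hws.ne_nil C' hC'')
    obtain rfl := cycle_eq_of_chain (hws.nodup_of_mem hC'') (hws.nodup_of_mem hC)
      (hws.chain _ hC'') (hws.chain _ hC) hd (hall d)
    exact (Multiset.nodup_cons.1 hws.nodup_cycles).1 hC'
  simp [ht]

theorem revProb_eq_commProb {G : Type*} [Group G] [Fintype G] (h : ℕ) :
    (revProb G (2 * h) : ℝ) = commProb G h :=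
  permProb_eq_commProb (by rw [numAltCycles_revPerm]; omega)

theorem revProb_eq_prob_reverse (G : Type*) [Group G] (m : ℕ) :
    revProb G m = prob G fun a : Fin m → G =>
      (List.ofFn a).prod = (List.ofFn a).reverse.prod := by
  have : ∀ a : Fin m → G, (List.ofFn fun i => a (Fin.revPerm i)) = (List.ofFn a).reverse := by
    intro a
    refine List.ext_getElem (by simp) fun i h1 h2 => ?_
    simp only [List.getElem_reverse, List.getElem_ofFn, List.length_ofFn, Fin.revPerm_apply]
    congr 1
    ext
    simp [Fin.val_rev]
    omega
  simp only [revProb, permProb, this]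

/-! ### Permutations with a given number of alternating cycles -/

theorem prob_castAdd (G : Type*) [Group G] [Finite G] {m : ℕ} (r : ℕ) (P : (Fin m → G) → Prop) :
    prob G (fun a : Fin (m + r) → G => P fun i => a (Fin.castAdd r i)) = prob G P := by
  have e : {a : Fin (m + r) → G // P fun i => a (Fin.castAdd r i)} ≃
      {b : Fin m → G // P b} × (Fin r → G) :=
    ((Fin.appendEquiv m r).symm.subtypeEquiv (q := fun p => P p.1) fun a => Iff.rfl).trans
      Equiv.prodSubtypeFstEquivSubtypeProd
  have hG : (Nat.card G : ℚ) ≠ 0 := Nat.cast_ne_zero.2 Nat.card_pos.ne'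
  rw [prob, prob, Nat.card_congr e, Nat.card_prod, Nat.card_fun, Nat.card_fin, pow_add]
  push_cast
  rw [mul_div_mul_right _ _ (pow_ne_zero _ hG)]

/-- Reverse the first `m` letters and fix the last `r`, which cancel from the equation. -/
theorem exists_permProb_eq_revProb (G : Type*) [Group G] [Finite G] (m r : ℕ) :
    ∃ φ : Equiv.Perm (Fin (m + r)), permProb G φ = revProb G m := by
  refine ⟨finSumFinEquiv.permCongr (Equiv.sumCongr Fin.revPerm (Equiv.refl _)), ?_⟩
  refine Eq.trans (congrArg (prob G) (funext fun a => ?_)) (prob_castAdd G r _)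
  rw [List.ofFn_add, List.ofFn_add, List.prod_append, List.prod_append]
  have hcast : ∀ i : Fin m, Fin.castLE (Nat.le_add_right m r) i = Fin.castAdd r i := fun _ => rfl
  simp [Equiv.permCongr_apply, hcast]

/-! ### The identity -/

theorem permProb_one (G : Type*) [Group G] [Finite G] (n : ℕ) :
    permProb G (1 : Equiv.Perm (Fin n)) = 1 := by
  have hG : (Nat.card G : ℚ) ≠ 0 := Nat.cast_ne_zero.2 Nat.card_pos.ne'
  rw [permProb, prob, Nat.card_congr (Equiv.subtypeUnivEquiv fun a : Fin n → G => by simp),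
    Nat.card_fun, Nat.card_fin, Nat.cast_pow, div_self (pow_ne_zero _ hG)]

theorem perm_three_not_comm : ¬ ∀ a b : Equiv.Perm (Fin 3), a * b = b * a := by decide

/-- No cycles need be counted: the probability is 1 in the non-abelian group S₃, and strict
monotonicity leaves only h = 0. -/
theorem numAltCycles_one (n : ℕ) : numAltCycles (1 : Equiv.Perm (Fin n)) = n + 1 := by
  obtain ⟨h, hh⟩ := exists_numAltCycles_add (1 : Equiv.Perm (Fin n))
  have h1 := permProb_eq_commProb (G := Equiv.Perm (Fin 3)) hh
  rw [permProb_one, Rat.cast_one, ← commProb_zero (G := Equiv.Perm (Fin 3))] at h1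
  have := (commProb_strictAnti perm_three_not_comm).injective h1
  omega

theorem nextEdge_ne {n : ℕ} (s : Equiv.Perm (Fin (n + 1))) (d : Fin (n + 1) ⊕ Fin (n + 1)) :
    nextEdge s d ≠ d := by
  rcases d with x | x <;> simp [nextEdge]

theorem two_le_length {n : ℕ} {s : Equiv.Perm (Fin (n + 1))}
    {C : Cycle (Fin (n + 1) ⊕ Fin (n + 1))} (h : C ≠ Cycle.nil)
    (hc : C.Chain fun x y => nextEdge s x = y) : 2 ≤ C.length := by
  obtain ⟨d, hd⟩ := exists_mem_of_ne_nil h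
  obtain ⟨L, rfl⟩ := exists_cons_of_mem hd
  cases L with
  | nil => exact absurd ((Cycle.chain_singleton _ _).1 hc) (nextEdge_ne s d)
  | cons e L => simp

theorem sum_length_eq {D : Type*} [Fintype D] {c : D → D} {ws : Multiset (Cycle D)}
    (h : IsCycleDecomposition c ws) : (ws.map Cycle.length).sum = Fintype.card D := by
  classical
  have : (ws.bind Cycle.toMultiset).toFinset = Finset.univ := by
    ext d
    obtain ⟨C, hC, hd⟩ := h.exists_mem d
    simpa using ⟨C, hC, mem_toMultiset.2 hd⟩
  rw [← Finset.card_univ, ← this, Multiset.toFinset_card_of_nodup h.nodup, Multiset.card_bind]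
  simp

/-- There are 2n + 2 edges and n + 1 cycles, each of length at least 2, so all have length exactly
2. -/
theorem nextEdge_nextEdge {n : ℕ} {φ : Equiv.Perm (Fin n)} (h : numAltCycles φ = n + 1)
    (d : Fin (n + 1) ⊕ Fin (n + 1)) :
    nextEdge (vertexPerm φ) (nextEdge (vertexPerm φ) d) = d := by
  obtain ⟨ws, hws⟩ := exists_isCycleDecomposition φ
  rw [numAltCycles_eq_card hws] at h
  obtain ⟨C, hC, hd⟩ := hws.exists_mem d
  have hlen : C.length ≤ 2 := by
    have hsum := sum_length_eq hws
    obtain ⟨t, rfl⟩ := Multiset.exists_cons_of_mem hC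
    have ht : Multiset.card (t.map Cycle.length) • 2 ≤ (t.map Cycle.length).sum := by
      refine Multiset.card_nsmul_le_sum fun l hl => ?_
      obtain ⟨C', hC', rfl⟩ := Multiset.mem_map.1 hl
      have := Multiset.mem_cons_of_mem (b := C) hC'
      exact two_le_length (hws.ne_nil C' this) (hws.chain C' this)
    simp at hsum ht h
    omega
  have hc := hws.chain C hC
  obtain ⟨L, rfl⟩ := exists_cons_of_mem hd
  rcases L with _ | ⟨e, _ | ⟨f, L⟩⟩
  · exact absurd ((Cycle.chain_singleton _ _).1 hc) (nextEdge_ne _ d)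
  · rw [Cycle.chain_coe_cons] at hc
    simp at hc
    rw [hc.1, hc.2]
  · simp at hlen

theorem eq_one_of_numAltCycles_eq {n : ℕ} {φ : Equiv.Perm (Fin n)}
    (h : numAltCycles φ = n + 1) : φ = 1 := by
  -- The 2-cycle through the grey edge at `x` shows that the inverse commutes with adding 1; as it
  -- fixes 0, it is the identity.
  have hs : ∀ x, (vertexPerm φ).symm (x + 1) = (vertexPerm φ).symm x + 1 := by
    intro x
    have := Sum.inl_injective (nextEdge_nextEdge h (Sum.inl x))
    rw [← Equiv.eq_symm_apply, sub_eq_iff_eq_add] at this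
    exact this
  have hid : ∀ x, (vertexPerm φ).symm x = x := by
    intro x
    induction x using Fin.induction with
    | zero => rw [Equiv.symm_apply_eq, vertexPerm_zero]
    | succ i ih => rw [← Fin.coeSucc_eq_succ, hs, ih]
  ext i
  have := hid i.succ
  rw [Equiv.symm_apply_eq, vertexPerm_succ] at this
  rw [← Fin.succ_injective _ this]
  rfl

/-! ### The spectrum -/

section Spectrum

variable {G : Type*} [Group G] [Finite G]

theorem permProb_eq_iff (hG : ¬ ∀ a b : G, a * b = b * a) {n : ℕ} (φ θ : Equiv.Perm (Fin n)) :
    permProb G φ = permProb G θ ↔ numAltCycles φ = numAltCycles θ := by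
  cases nonempty_fintype G
  obtain ⟨h, hh⟩ := exists_numAltCycles_add φ
  obtain ⟨h', hh'⟩ := exists_numAltCycles_add θ
  rw [← Rat.cast_inj (α := ℝ), permProb_eq_commProb hh, permProb_eq_commProb hh',
    (commProb_strictAnti hG).injective.eq_iff]
  omega

theorem bijOn_spec (hG : ¬ ∀ a b : G, a * b = b * a) (n : ℕ) :
    Set.BijOn (fun p : ℚ => {π : Equiv.Perm (Fin n) | permProb G π = p})
      (spec G n) (hultmanDecomposition n) := by
  have hclass : ∀ φ : Equiv.Perm (Fin n),
      {π : Equiv.Perm (Fin n) | permProb G π = permProb G φ} = hultmanClass φ :=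
    fun φ => Set.ext fun π => permProb_eq_iff hG π φ
  refine ⟨?_, ?_, ?_⟩
  · rintro _ ⟨φ, rfl⟩
    exact ⟨φ, (hclass φ).symm⟩
  · rintro _ ⟨φ, rfl⟩ q _ h
    exact (Set.ext_iff.1 h φ).1 rfl
  · rintro _ ⟨φ, rfl⟩
    exact ⟨_, ⟨φ, rfl⟩, hclass φ⟩

theorem ncard_spec (hG : ¬ ∀ a b : G, a * b = b * a) (n : ℕ) :
    (spec G n).ncard = n / 2 + 1 := by
  cases nonempty_fintype G
  have himage : ((↑) : ℚ → ℝ) '' spec G n = commProb G '' (Finset.range (n / 2 + 1) : Set ℕ) := by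
    ext x
    constructor
    · rintro ⟨_, ⟨φ, rfl⟩, rfl⟩
      obtain ⟨h, hh⟩ := exists_numAltCycles_add φ
      -- At least one alternating cycle forces 2h ≤ n, the upper bound on the spectrum.
      have hpos : numAltCycles φ ≠ 0 := by
        obtain ⟨ws, hws⟩ := exists_isCycleDecomposition φ
        obtain ⟨C, hC, -⟩ := hws.exists_mem (Sum.inl 0)
        rw [numAltCycles_eq_card hws]
        intro h0
        rw [Multiset.card_eq_zero.1 h0] at hC
        exact Multiset.notMem_zero _ hC
      refine ⟨h, ?_, (permProb_eq_commProb hh).symm⟩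
      rw [Finset.mem_coe, Finset.mem_range]
      omega
    · rintro ⟨h, hh, rfl⟩
      rw [Finset.mem_coe, Finset.mem_range] at hh
      obtain ⟨r, rfl⟩ := Nat.exists_eq_add_of_le (show 2 * h ≤ n by omega)
      obtain ⟨φ, hφ⟩ := exists_permProb_eq_revProb G (2 * h) r
      exact ⟨_, ⟨φ, rfl⟩, by rw [← revProb_eq_commProb, ← hφ]⟩
  rw [← Set.ncard_image_of_injective _ (Rat.cast_injective (α := ℝ)), himage,
    Set.ncard_image_of_injective _ (commProb_strictAnti hG).injective, Set.ncard_coe_finset,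
    Finset.card_range]

theorem permProb_eq_revProb {n : ℕ} (φ : Equiv.Perm (Fin n)) :
    permProb G φ = revProb G (n + 1 - numAltCycles φ) := by
  cases nonempty_fintype G
  obtain ⟨h, hh⟩ := exists_numAltCycles_add φ
  rw [show n + 1 - numAltCycles φ = 2 * h by omega, ← Rat.cast_inj (α := ℝ),
    permProb_eq_commProb hh, revProb_eq_commProb]

end Spectrum

end Hultman

theorem mainTheorem1 {G : Type*} [Group G] [Finite G] (n : ℕ) :
    -- (a)
    (∀ (φ : Equiv.Perm (Fin n)) (k : ℕ), Hultman.numAltCycles φ = k →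
      (k ≤ n + 1) ∧
      (k ≤ n →
        (k + 1 ≤ n ∧ Odd (n - k)) ∧
        Hultman.permProb G φ = Hultman.revProb G (n + 1 - k) ∧
        Hultman.revProb G (n + 1 - k) =
          Hultman.prob G (fun a : Fin (n + 1 - k) → G =>
            (List.ofFn a).prod = (List.ofFn a).reverse.prod)) ∧
      (k = n + 1 ↔ φ = 1) ∧
      (k = n + 1 → Hultman.permProb G φ = 1)) ∧
    -- (b)
    ((¬ ∀ a b : G, a * b = b * a) →
      (∀ φ θ : Equiv.Perm (Fin n),
        Hultman.permProb G φ = Hultman.permProb G θ ↔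
          Hultman.numAltCycles φ = Hultman.numAltCycles θ) ∧
      Set.BijOn (fun p : ℚ => {π : Equiv.Perm (Fin n) | Hultman.permProb G π = p})
        (Hultman.spec G n) (Hultman.hultmanDecomposition n) ∧
      (Hultman.spec G n).ncard = n / 2 + 1) := by
  refine ⟨?_, fun hG =>
    ⟨Hultman.permProb_eq_iff hG, Hultman.bijOn_spec hG n, Hultman.ncard_spec hG n⟩⟩
  rintro φ k rfl
  obtain ⟨h, hh⟩ := Hultman.exists_numAltCycles_add φ
  refine ⟨by omega, fun hk => ⟨⟨by omega, ?_⟩, Hultman.permProb_eq_revProb φ,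
    Hultman.revProb_eq_prob_reverse G _⟩, ⟨Hultman.eq_one_of_numAltCycles_eq, ?_⟩, fun hk => ?_⟩
  -- Here n − k = 2h − 1, and k ≤ n gives h ≥ 1.
  · exact ⟨h - 1, by omega⟩
  · rintro rfl
    exact Hultman.numAltCycles_one n
  · rw [Hultman.eq_one_of_numAltCycles_eq hk, Hultman.permProb_one]
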